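/- Let $\mathbb{F}$ be a finite field, let $\mathbb{V}$ be a finite-dimensional and $\mathbb{U}$ an arbitrary vector space over $\mathbb{F}$, let $K\ge 1$, and let $g:\mathbb{V}\to\mathbb{U}$ be a polynomial map. Let $d=\deg g$ be the total degree of its canonical representation, the one in which every individual exponent is at most $|\mathbb{F}|-1$, and assume $d\ge 1$, i.e. $g$ is not constant. Put $f(X_1,\dots,X_K)=\sum_{k=1}^K g(X_k)$. A linear scheme with $N$ workers and $T$ keys consists of scalars $A_{wk},B_{wt},\ell_w\in\mathbb{F}$ ($1\le w\le N$, $1\le k\le K$, $1\le t\le T$). Worker $w$ stores $\tilde X_w=\sum_k A_{wk}X_k+\sum_t B_{wt}Z_t$, where $Z_1,\dots,Z_T$ are independent keys, uniform on $\mathbb{V}$ and independent of the dataset, and returns $g(\tilde X_w)$; the master outputs $\sum_w \ell_w\, g(\tilde X_w)$. The scheme is valid if this output equals $f(X_1,\dots,X_K)$ for all values of the inputs and of the keys. It is data-private if, for every probability distribution of $(X_1,\dots,X_K)$ and every $w$, the mutual information $I(X_1,\dots,X_K;\tilde X_w)$ is $0$. Harmonic Coding is the following linear scheme with a single key $Z$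 and $K(d-1)+2$ workers. Its parameters are $c\in\mathbb{F}\setminus\{0,1,\dots,K\}$ and pairwise distinct $\beta_1,\dots,\beta_{d-1}\in\mathbb{F}\setminus\big(\{0\}\cup\{\tfrac{c}{c-j}:0\le j\le K\}\big)$. Put $P_j=\frac{c}{c-j}Z-\frac{1}{c-j}\sum_{k=1}^{j}X_k$ for $0\le j\le K$. The first worker stores $P_0$, the last one stores $P_K$, and for $1\le i\le d-1$, $1\le j\le K$ worker $(i,j)$ stores $\tilde X_{(i,j)}=X_j\big(1-\beta_i\frac{c-j+1}{c}\big)+P_{j-1}\,\beta_i\frac{c-j+1}{c}$. The decoding coefficients are $$c\prod_{i=1}^{d-1}\frac{\beta_i c}{\beta_i c-c}\ \text{ for the first worker},\qquad -(c-K)\prod_{i=1}^{d-1}\frac{\beta_i(c-K)}{\beta_i(c-K)-c}\ \text{ for the last worker},$$ $$\frac{\frac{c-j+1}{c-j}}{\big(1-\beta_i\frac{c-j+1}{c}\big)\big(\frac{c-j+1}{c-j}-\beta_i\frac{c-j+1}{c}\big)}\prod_{i'\ne i}\frac{\beta_{i'}}{\beta_{i'}-\beta_i}\ \text{ for worker }(i,j).$$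 Then: (1) if $|\mathbb{F}|\ge K+d+1$, admissible parameters $c,\beta_1,\dots,\beta_{d-1}$ exist, and for all admissible parameters Harmonic Coding is valid and data-private; it uses $K(d-1)+2$ workers; (2) if $\operatorname{char}\mathbb{F}>d$, every valid data-private linear scheme, with any number of keys, uses at least $K(d-1)+2$ workers. -/

import Mathlib

open scoped BigOperators

noncomputable section

/-! ### Polynomial maps between vector spaces, in coordinates -/

section PolynomialMaps

variable {F V U ι : Type*} [Field F] [AddCommGroup V] [Module F V] [AddCommGroup U] [Module F U]

/-- The value at `v` of the polynomial `∑ m, a m • x ^ m` with coefficients in `U`, where the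
variables `x i` are the coordinates of `v` in the basis `b`. -/
def polyEval [Fintype ι] (b : Module.Basis ι F V) (a : (ι →₀ ℕ) →₀ U) (v : V) : U :=
  a.sum fun m u => (∏ i, b.repr v i ^ m i) • u

/-- The polynomial with coefficients `a` is in canonical form: in each of its terms every variable
has exponent at most `|F| - 1`. -/
def IsCanonical (F : Type*) [Fintype F] (a : (ι →₀ ℕ) →₀ U) : Prop :=
  ∀ m ∈ a.support, ∀ i, m i ≤ Fintype.card F - 1

/-- The total degree of the polynomial with coefficients `a`. -/
def polyDegree [Fintype ι] (a : (ι →₀ ℕ) →₀ U) : ℕ :=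
  a.support.sup fun m => ∑ i, m i

end PolynomialMaps

/-! ### Mutual information of finite random variables -/

/-- The mutual information `I(A; B)` (in nats) of a pair of random variables with finitely many
values and joint law `p`. Terms with `p (a, b) = 0` contribute `0`. -/
def mutualInfo {A B : Type*} [Fintype A] [Fintype B] (p : PMF (A × B)) : ℝ :=
  ∑ a, ∑ b, (p (a, b)).toReal *
    Real.log ((p (a, b)).toReal / (((p.map Prod.fst) a).toReal * ((p.map Prod.snd) b).toReal))

/-! ### Linear coding schemes -/

/-- A linear coding scheme for `K` inputs, with `T` independent uniformly random keys and workers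
indexed by `W`: each worker stores a linear combination of the inputs and the keys, and the master
outputs a linear combination of what the workers return. All coefficients are scalars. -/
structure LinearScheme (F : Type*) (K T : ℕ) (W : Type*) where
  inputCoeff : W → Fin K → F
  keyCoeff : W → Fin T → F
  decCoeff : W → F

namespace LinearScheme

variable {F W : Type*} {K T : ℕ} [Field F]

/-- The coded variable stored by worker `w` on inputs `x` and keys `z`. -/
def encode {V : Type*} [AddCommGroup V] [Module F V]
    (S : LinearScheme F K T W) (w : W) (x : Fin K → V) (z : Fin T → V) : V :=
  ∑ k, S.inputCoeff w k • x k + ∑ t, S.keyCoeff w t • z t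

/-- The output of the master when the workers return `y`. -/
def decode {U : Type*} [AddCommGroup U] [Module F U] [Fintype W]
    (S : LinearScheme F K T W) (y : W → U) : U :=
  ∑ w, S.decCoeff w • y w

/-- The scheme computes `g (X 1) + ... + g (X K)`, whatever the inputs and the keys are, when every
worker applies `g` to its coded variable. -/
def IsValid {V U : Type*} [AddCommGroup V] [Module F V] [AddCommGroup U] [Module F U] [Fintype W]
    (S : LinearScheme F K T W) (g : V → U) : Prop :=
  ∀ (x : Fin K → V) (z : Fin T → V), S.decode (fun w => g (S.encode w x z)) = ∑ k, g (x k)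

/-- The joint law of the dataset and the coded variable of worker `w`, when the dataset has law `μ`
and the keys are independent, uniform on `V`, and independent of the dataset. -/
def jointLaw {V : Type*} [AddCommGroup V] [Module F V] [Fintype V]
    (S : LinearScheme F K T W) (w : W) (μ : PMF (Fin K → V)) : PMF ((Fin K → V) × V) :=
  μ.bind fun x => (PMF.uniformOfFintype (Fin T → V)).map fun z => (x, S.encode w x z)

/-- Data privacy for inputs in `V`: for every law of the dataset and every worker, the mutual
information of the dataset and the worker's coded variable vanishes. -/
def IsPrivate (V : Type*) [AddCommGroup V] [Module F V] [Fintype V]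
    (S : LinearScheme F K T W) : Prop :=
  ∀ (w : W) (μ : PMF (Fin K → V)), mutualInfo (S.jointLaw w μ) = 0

end LinearScheme

/-! ### Harmonic Coding -/

section Harmonic

variable {F : Type*} [Field F]

/-- Admissible parameters of Harmonic Coding for `K` inputs and degree `d`. -/
structure IsHarmonicParam (K d : ℕ) (c : F) (β : Fin (d - 1) → F) : Prop where
  c_ne : ∀ j : ℕ, j ≤ K → c ≠ (j : F)
  injective : Function.Injective β
  ne_zero : ∀ i, β i ≠ 0
  ne_harmonic : ∀ i, ∀ j : ℕ, j ≤ K → β i ≠ c / (c - (j : F))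

/-- The workers of Harmonic Coding: a first one, `d - 1` workers in each of `K` groups
(`(i, j)` is worker `i` of group `j`), and a last one. -/
abbrev HarmonicWorker (K d : ℕ) : Type := Unit ⊕ (Fin (d - 1) × Fin K) ⊕ Unit

/-- The coefficient of input `k` in `P j = (c / (c - j)) Z - (1 / (c - j)) (X 1 + ... + X j)`;
the index `k` starts from `0`. -/
def harmonicPInput {K : ℕ} (c : F) (j : ℕ) (k : Fin K) : F :=
  if (k : ℕ) < j then -(1 / (c - (j : F))) else 0

/-- The coefficient of the key `Z` in `P j`. -/
def harmonicPKey (c : F) (j : ℕ) : F := c / (c - (j : F))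

/-- Harmonic Coding with parameters `c` and `β`; it uses one key. The first and the last worker
store `P 0` and `P K`. With groups counted from `0`, worker `i` of group `j` stores
`(1 - β i (c - j) / c) X + (β i (c - j) / c) (P j)`, where `X` is the input with index `j`. -/
def harmonicScheme (K d : ℕ) (c : F) (β : Fin (d - 1) → F) :
    LinearScheme F K 1 (HarmonicWorker K d) where
  inputCoeff w k := match w with
    | .inl _ => harmonicPInput c 0 k
    | .inr (.inl (i, j)) =>
        (if k = j then 1 - β i * ((c - ((j : ℕ) : F)) / c) else 0)
          + β i * ((c - ((j : ℕ) : F)) / c) * harmonicPInput c (j : ℕ) k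
    | .inr (.inr _) => harmonicPInput c K k
  keyCoeff w _ := match w with
    | .inl _ => harmonicPKey c 0
    | .inr (.inl (i, j)) => β i * ((c - ((j : ℕ) : F)) / c) * harmonicPKey c (j : ℕ)
    | .inr (.inr _) => harmonicPKey c K
  decCoeff w := match w with
    | .inl _ => c * ∏ i, (β i * c / (β i * c - c))
    | .inr (.inl (i, j)) =>
        ((c - ((j : ℕ) : F)) / (c - (((j : ℕ) + 1 : ℕ) : F)))
          / ((1 - β i * ((c - ((j : ℕ) : F)) / c))
            * ((c - ((j : ℕ) : F)) / (c - (((j : ℕ) + 1 : ℕ) : F))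
                - β i * ((c - ((j : ℕ) : F)) / c)))
          * ∏ i' ∈ Finset.univ.erase i, (β i' / (β i' - β i))
    | .inr (.inr _) =>
        -((c - (K : F)) * ∏ i, (β i * (c - (K : F)) / (β i * (c - (K : F)) - c)))

end Harmonic

end

/-! Achievability. The variables `P_{j-1}`, `P_j` and the codes of group `j` all have the form `X_j
+ t Y`, with `t` equal to `c/(c-j+1)`, `c/(c-j)` and the `β_i`. Composed with any linear form, `g`
is a polynomial in `t` of degree at most `d`, so its value at `t = 0` is interpolated from these `d
+ 1` points (`eval_zero_eq_harmonic`). Since `c-j+1` and `c-j` differ by `1`, the weight of `P_j` is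
the same, up to sign, in the two groups that use it. Summed over the groups, these terms telescope
and only `P_0` and `P_K` survive. Privacy holds because every worker gives the key a nonzero
coefficient.

Lower bound. Each worker is a vector in `F^(K+T)`, and each input is a unit vector. On a suitable
line through the origin a linear form of `g` is a polynomial of degree exactly `d`. Validity on this
line, polarized (`sum_coeff_mul_prod_eq_zero`, where `d!` must be invertible), says that every
product of `d` linear forms has weighted sum zero over the workers and the inputs, the latter with
weight `-1`. Privacy makes a worker without keys the zero vector; all others lie outside the span of
the inputs.

It remains to count points in such a relation. If no larger subspace has many more points than `Y`,
a covering theorem of matroid-union type changes the `d` forms off `Y` so that their product kills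
all points outside `Y`; then the points in `Y` form a relation themselves. Hence every input lies in
a subrelation spanning some `Y` with at least `d (dim Y - 1) + 2` points. Comparing `dim Y` with the
number of inputs in it gives the bound for this subrelation; removing it and repeating gives the
bound for all inputs. -/

/-! ### Covering points by hyperplanes -/

open Module in
/-- A covering theorem of Edmonds type. Under a Hall condition on the points `vec x`, `x ∈ X`, and
the subspaces `Y i`, linear forms can be changed outside the `Y i` so that at every point one of
them vanishes. -/
theorem exists_forms_vanishing {F V Γ J : Type*} [Field F] [AddCommGroup V] [Module F V]
    [FiniteDimensional F V] [Fintype J] (vec : Γ → V) :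
    ∀ (X : Finset Γ) (Y : J → Submodule F V),
      (∀ A ⊆ X, A.card + ∑ i, finrank F (Y i)
        ≤ ∑ i, finrank F (Y i ⊔ Submodule.span F (vec '' A) : Submodule F V)) →
      ∀ l : J → Dual F V, ∃ l' : J → Dual F V,
        (∀ i, ∀ y ∈ Y i, l' i y = l i y) ∧ ∀ x ∈ X, ∃ i, l' i (vec x) = 0 := by
  classical
  intro X
  induction X using Finset.strongInduction with
  | H X ih =>
    intro Y hY l
    rcases X.eq_empty_or_nonempty with rfl | ⟨x, hx⟩
    · exact ⟨l, by simp, by simp⟩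
    -- As in Hall's theorem, split on a tight subset `A`. If there is one, treat `A` first, then
    -- freeze the forms on its span; subtracting the equality for `A` from the condition for `A ∪ B`
    -- gives the condition for `B`.
    by_cases ht : ∃ A ⊂ X, A.Nonempty ∧ A.card + ∑ i, finrank F (Y i)
        = ∑ i, finrank F (Y i ⊔ Submodule.span F (vec '' A) : Submodule F V)
    · obtain ⟨A, hAX, hA, hcard⟩ := ht
      obtain ⟨l₁, h₁, h₁'⟩ := ih A hAX Y (fun B hB => hY B (hB.trans hAX.subset)) l
      obtain ⟨l₂, h₂, h₂'⟩ := ih (X \ A) (Finset.sdiff_ssubset hAX.subset hA)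
        (fun i => Y i ⊔ Submodule.span F (vec '' A)) (by
          intro B hB
          have hdis : Disjoint A B :=
            Finset.disjoint_of_subset_right hB Finset.disjoint_sdiff
          have h := hY (A ∪ B) (Finset.union_subset hAX.subset (hB.trans Finset.sdiff_subset))
          rw [Finset.card_union_of_disjoint hdis, Finset.coe_union, Set.image_union,
            Submodule.span_union] at h
          have h' : ∀ i, finrank F (Y i ⊔ Submodule.span F (vec '' A)
              ⊔ Submodule.span F (vec '' B) : Submodule F V) = finrank F (Y i ⊔
              (Submodule.span F (vec '' A) ⊔ Submodule.span F (vec '' B)) : Submodule F V) :=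
            fun i => by rw [sup_assoc]
          simp only [h']
          omega) l₁
      refine ⟨l₂, fun i y hy => ?_, fun y hy => ?_⟩
      · rw [h₂ i y (Submodule.mem_sup_left hy), h₁ i y hy]
      · by_cases hyA : y ∈ A
        · obtain ⟨i, hi⟩ := h₁' y hyA
          refine ⟨i, ?_⟩
          rw [h₂ i _ (Submodule.mem_sup_right (Submodule.subset_span ⟨y, hyA, rfl⟩)), hi]
        · exact h₂' y (Finset.mem_sdiff.2 ⟨hy, hyA⟩)
    -- Without tight subsets every nonempty proper subset has slack at least `1`. This pays for
    -- adding `vec x` to one `Y i`, which raises the sum of dimensions by exactly `1`.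
    · push Not at ht
      obtain ⟨i, hi⟩ : ∃ i, vec x ∉ Y i := by
        by_contra! hall
        have h := hY {x} (by simpa using hx)
        have h2 : ∀ i, finrank F (Y i ⊔ Submodule.span F (vec '' (({x} : Finset Γ) : Set Γ)) :
            Submodule F V) = finrank F (Y i) := by
          intro i
          rw [sup_eq_left.2]
          simpa using hall i
        simp only [h2, Finset.card_singleton] at h
        omega
      have hdis : Y i ⊓ Submodule.span F {vec x} = ⊥ := by
        rw [← disjoint_iff, Submodule.disjoint_span_singleton' (by rintro h; simp [h] at hi)]
        exact hi
      obtain ⟨m, hm, hm'⟩ : ∃ m : Dual F V, (∀ y ∈ Y i, m y = l i y) ∧ m (vec x) = 0 := by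
        obtain ⟨φ, hφ, hφY⟩ := Submodule.exists_le_ker_of_notMem hi
        refine ⟨l i - (l i (vec x) / φ (vec x)) • φ, fun y hy => ?_, ?_⟩
        · have : φ y = 0 := hφY hy
          simp [this]
        · simp [hφ]
      set Y' : J → Submodule F V :=
        Function.update Y i (Y i ⊔ Submodule.span F {vec x}) with hY'
      have hle : ∀ j, Y j ≤ Y' j := by
        intro j
        by_cases hj : j = i
        · subst hj; simp [hY']
        · simp [hY', hj]
      have hsum : ∑ j, finrank F (Y' j) = ∑ j, finrank F (Y j) + 1 := by
        have h1 : finrank F (Y i ⊔ Submodule.span F {vec x} : Submodule F V)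
            = finrank F (Y i) + 1 := by
          have := Submodule.finrank_sup_add_finrank_inf_eq (Y i) (Submodule.span F {vec x})
          rw [hdis, finrank_bot, finrank_span_singleton (by rintro h; simp [h] at hi)] at this
          simpa using this
        rw [← Finset.add_sum_erase _ _ (Finset.mem_univ i),
          ← Finset.add_sum_erase _ (fun j => finrank F (Y j)) (Finset.mem_univ i)]
        have h2 : ∑ j ∈ Finset.univ.erase i, finrank F (Y' j)
            = ∑ j ∈ Finset.univ.erase i, finrank F (Y j) := by
          refine Finset.sum_congr rfl fun j hj => ?_
          rw [hY', Function.update_of_ne (Finset.ne_of_mem_erase hj)]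
        rw [h2, hY', Function.update_self, h1]
        omega
      obtain ⟨l₂, h₂, h₂'⟩ := ih (X.erase x) (Finset.erase_ssubset hx) Y' (by
          intro B hB
          rcases B.eq_empty_or_nonempty with rfl | hBne
          · rw [Finset.card_empty, zero_add]
            exact Finset.sum_le_sum fun j _ => Submodule.finrank_mono le_sup_left
          have hBX : B ⊂ X := hB.trans_ssubset (Finset.erase_ssubset hx)
          have h1 := hY B hBX.subset
          have h2 := ht B hBX hBne
          have h3 : ∑ j, finrank F (Y j ⊔ Submodule.span F (vec '' B) : Submodule F V)
              ≤ ∑ j, finrank F (Y' j ⊔ Submodule.span F (vec '' B) : Submodule F V) :=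
            Finset.sum_le_sum fun j _ =>
              Submodule.finrank_mono (sup_le_sup_right (hle j) _)
          omega) (Function.update l i m)
      refine ⟨l₂, fun j y hy => ?_, fun y hy => ?_⟩
      · rw [h₂ j y (hle j hy)]
        by_cases hj : j = i
        · subst hj; simpa using hm y hy
        · simp [hj]
      · by_cases hyx : y = x
        · subst hyx
          refine ⟨i, ?_⟩
          rw [h₂ i _ (by
            rw [hY', Function.update_self]
            exact Submodule.mem_sup_right (Submodule.mem_span_singleton_self _))]
          simpa using hm'
        · exact h₂' y (Finset.mem_erase.2 ⟨hyx, hy⟩)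

/-! ### Power relations and dense subspaces -/

/-- The weighted points `vec γ`, `γ ∈ s`, satisfy a relation in degree `d`: every product of `d`
linear forms has weighted sum zero over them. -/
def IsPowerRelation {F V Γ : Type*} [Field F] [AddCommGroup V] [Module F V]
    (d : ℕ) (vec : Γ → V) (c : Γ → F) (s : Finset Γ) : Prop :=
  ∀ l : Fin d → Module.Dual F V, ∑ γ ∈ s, c γ * ∏ i, l i (vec γ) = 0

section PowerRelation

variable {F V Γ : Type*} [Field F] [AddCommGroup V] [Module F V] {d : ℕ} {vec : Γ → V} {c : Γ → F}

theorem IsPowerRelation.sdiff [DecidableEq Γ] {s t : Finset Γ} (hs : IsPowerRelation d vec c s)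
    (ht : IsPowerRelation d vec c t) (hts : t ⊆ s) : IsPowerRelation d vec c (s \ t) := by
  intro l
  rw [Finset.sum_sdiff_eq_sub hts, hs l, ht l, sub_zero]

open Classical in
/-- If the part of a relation on a subspace `Y` is not a relation, then `Y` is contained in a
subspace with many more of the points. -/
theorem IsPowerRelation.exists_lt [FiniteDimensional F V] {s : Finset Γ}
    (hs : IsPowerRelation d vec c s) (Y : Submodule F V)
    (hY : ¬ IsPowerRelation d vec c (s.filter fun γ => vec γ ∈ Y)) :
    ∃ Y' : Submodule F V, Y < Y' ∧
      (s.filter fun γ => vec γ ∈ Y).card + d * Module.finrank F Y' + 1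
        ≤ (s.filter fun γ => vec γ ∈ Y').card + d * Module.finrank F Y := by
  by_contra! hcon
  refine hY fun l => ?_
  -- The negated conclusion is the Hall condition for `d` copies of `Y`. The new forms agree with
  -- `l` on `Y` and have product zero at the other points of `s`.
  obtain ⟨l', h1, h2⟩ := exists_forms_vanishing (F := F) vec (s.filter fun γ => vec γ ∉ Y)
    (fun _ : Fin d => Y) (by
      intro A hA
      rcases A.eq_empty_or_nonempty with rfl | ⟨x, hx⟩
      · rw [Finset.card_empty, zero_add]
        exact Finset.sum_le_sum fun j _ => Submodule.finrank_mono le_sup_left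
      have hAs : ∀ γ ∈ A, γ ∈ s ∧ vec γ ∉ Y := fun γ hγ => by simpa using hA hγ
      have hmem : ∀ γ ∈ A, vec γ ∈ Submodule.span F (vec '' A) := fun γ hγ =>
        Submodule.subset_span ⟨γ, hγ, rfl⟩
      have hlt : Y < Y ⊔ Submodule.span F (vec '' A) := by
        refine lt_of_le_of_ne le_sup_left fun h => (hAs x hx).2 ?_
        rw [h]
        exact Submodule.mem_sup_right (hmem x hx)
      have h := hcon _ hlt
      have hcard : (s.filter fun γ => vec γ ∈ Y).card + A.card
          ≤ (s.filter fun γ => vec γ ∈ Y ⊔ Submodule.span F (vec '' A)).card := by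
        rw [← Finset.card_union_of_disjoint]
        · refine Finset.card_le_card fun γ hγ => ?_
          rcases Finset.mem_union.1 hγ with h | h
          · rw [Finset.mem_filter] at h ⊢
            exact ⟨h.1, Submodule.mem_sup_left h.2⟩
          · exact Finset.mem_filter.2 ⟨(hAs γ h).1, Submodule.mem_sup_right (hmem γ h)⟩
        · rw [Finset.disjoint_left]
          intro γ h h'
          exact (hAs γ h').2 (Finset.mem_filter.1 h).2
      simp only [Finset.sum_const, Finset.card_univ, Fintype.card_fin, smul_eq_mul]
      omega) l
  have h3 := hs l'
  rw [← Finset.sum_filter_add_sum_filter_not s (fun γ => vec γ ∈ Y),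
    Finset.sum_eq_zero (s := s.filter fun γ => vec γ ∉ Y), add_zero] at h3
  · rw [← h3]
    refine Finset.sum_congr rfl fun γ hγ => ?_
    simp_rw [h1 _ _ (Finset.mem_filter.1 hγ).2]
  · intro γ hγ
    obtain ⟨i, hi⟩ := h2 γ hγ
    rw [Finset.prod_eq_zero (Finset.mem_univ i) hi, mul_zero]

open Classical in
/-- A subspace with `m` more points than `d` times its dimension can be enlarged until its points
form a relation. -/
theorem IsPowerRelation.exists_subspace [FiniteDimensional F V] {s : Finset Γ}
    (hs : IsPowerRelation d vec c s) (m : ℤ) (Y : Submodule F V)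
    (hY : m + d * Module.finrank F Y ≤ (s.filter fun γ => vec γ ∈ Y).card) :
    ∃ Y' : Submodule F V, Y ≤ Y' ∧ IsPowerRelation d vec c (s.filter fun γ => vec γ ∈ Y') ∧
      m + d * Module.finrank F Y' ≤ (s.filter fun γ => vec γ ∈ Y').card := by
  induction Y using WellFoundedGT.induction with
  | ind Y ih =>
    by_cases h : IsPowerRelation d vec c (s.filter fun γ => vec γ ∈ Y)
    · exact ⟨Y, le_rfl, h, hY⟩
    -- The number of points minus `d` times the dimension increases from `Y` to `Z`, so the lower
    -- bound `m` persists.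
    · obtain ⟨Z, hYZ, hZ⟩ := hs.exists_lt Y h
      obtain ⟨Y', h1, h2⟩ := ih Z hYZ (by zify at hZ; linarith)
      exact ⟨Y', hYZ.le.trans h1, h2⟩

open Classical in
/-- A relation containing a nonzero point with nonzero weight that spans none of the other points
contains a relation through this point with many points. -/
theorem IsPowerRelation.exists_dense [FiniteDimensional F V] {s : Finset Γ}
    (hs : IsPowerRelation d vec c s) {p : Γ} (hp : p ∈ s) (hvp : vec p ≠ 0) (hcp : c p ≠ 0)
    (hspan : ∀ γ ∈ s, vec γ ∈ Submodule.span F {vec p} → γ = p) :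
    ∃ Y : Submodule F V, vec p ∈ Y ∧ IsPowerRelation d vec c (s.filter fun γ => vec γ ∈ Y) ∧
      d * Module.finrank F Y + 2 ≤ (s.filter fun γ => vec γ ∈ Y).card + d := by
  have hf : (s.filter fun γ => vec γ ∈ Submodule.span F {vec p}) = {p} := by
    ext γ
    simp only [Finset.mem_filter, Finset.mem_singleton]
    refine ⟨fun h => hspan γ h.1 h.2, ?_⟩
    rintro rfl
    exact ⟨hp, Submodule.mem_span_singleton_self _⟩
  obtain ⟨Y, hY, hcard⟩ := hs.exists_lt (Submodule.span F {vec p}) (by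
    rw [hf]
    intro h
    obtain ⟨φ, hφ⟩ := Module.Projective.exists_dual_ne_zero F hvp
    have := h fun _ => φ
    simp [hcp] at this
    exact hφ this.1)
  rw [hf, finrank_span_singleton hvp] at hcard
  -- The line of `p` has one point, hence excess `1 - d`; the first enlargement gains at least one
  -- more.
  obtain ⟨Y', h1, h2, h3⟩ := hs.exists_subspace (2 - d) Y (by
    simp at hcard; zify at hcard; linarith)
  refine ⟨Y', h1 (hY.le (Submodule.mem_span_singleton_self _)), h2, ?_⟩
  zify
  linarith

end PowerRelation

/-- A relation in degree `d` between linearly independent points and points outside their span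
involves at least `d - 1` of the latter for each of the former, and two more. -/
theorem IsPowerRelation.le_card_toLeft {F V W κ : Type*} [Field F] [AddCommGroup V] [Module F V]
    [FiniteDimensional F V] [DecidableEq W] [DecidableEq κ] {n : ℕ} {v : W → V} {e : κ → V}
    (he : LinearIndependent F e) (hv : ∀ w, v w ∉ Submodule.span F (Set.range e))
    {c : W ⊕ κ → F} (hc : ∀ k, c (.inr k) ≠ 0) (s : Finset (W ⊕ κ))
    (hs : IsPowerRelation (n + 1) (Sum.elim v e) c s) (hne : s.toRight.Nonempty) :
    n * s.toRight.card + 2 ≤ s.toLeft.card := by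
  classical
  induction s using Finset.strongInduction with
  | H s ih =>
    obtain ⟨k, hk⟩ := hne
    have hks : Sum.inr k ∈ s := Finset.mem_toRight.1 hk
    obtain ⟨Y, hkY, hrel, hcard⟩ := hs.exists_dense hks (he.ne_zero k) (hc k) (by
      rintro (w | j) hγ hmem
      · refine absurd (Submodule.span_mono ?_ hmem) (hv w)
        simp
      · by_contra hjk
        refine he.notMem_span_image (s := {k}) (x := j) ?_ (by simpa using hmem)
        simpa using hjk)
    set t := s.filter fun γ => Sum.elim v e γ ∈ Y with ht
    have hts : t ⊆ s := Finset.filter_subset _ _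
    have hkt : Sum.inr k ∈ t := Finset.mem_filter.2 ⟨hks, hkY⟩
    have hspan : Submodule.span F (e '' t.toRight) ≤ Y := by
      rw [Submodule.span_le]
      rintro _ ⟨j, hj, rfl⟩
      exact (Finset.mem_filter.1 (Finset.mem_toRight.1 hj)).2
    have hrank : Module.finrank F (Submodule.span F (e '' t.toRight)) = t.toRight.card := by
      have h := finrank_span_eq_card (he.comp ((↑) : t.toRight → κ) Subtype.val_injective)
      rw [Set.range_comp, Subtype.range_coe_subtype, Fintype.card_coe] at h
      exact h
    have hsplit : t.toLeft.card + t.toRight.card = t.card := Finset.card_toLeft_add_card_toRight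
    have hmain : n * t.toRight.card + 2 ≤ t.toLeft.card := by
      have h0 := Submodule.finrank_mono hspan
      -- Independent points alone are too few to be dense. A point off their span forces the
      -- dimension of `Y` to be at least `t.toRight.card + 1`, and this extra dimension gives the
      -- bound.
      rcases t.toLeft.eq_empty_or_nonempty with h | ⟨w, hw⟩
      · rw [h, Finset.card_empty, zero_add] at hsplit
        have h1 : t.toRight.card ≤ Module.finrank F Y := hrank ▸ h0
        have h2 : 0 < t.toRight.card := Finset.card_pos.2 ⟨k, Finset.mem_toRight.2 hkt⟩
        have h3 : n * 1 ≤ n * Module.finrank F Y := Nat.mul_le_mul_left n (h2.trans_le h1)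
        linarith
      · have hlt : Submodule.span F (e '' t.toRight) < Y := by
          refine lt_of_le_of_ne hspan fun h => hv w ?_
          have : v w ∈ Y := (Finset.mem_filter.1 (Finset.mem_toLeft.1 hw)).2
          rw [← h] at this
          exact Submodule.span_mono (Set.image_subset_range _ _) this
        have h1 := Submodule.finrank_lt_finrank_of_lt hlt
        rw [hrank] at h1
        nlinarith
    have hl : (s \ t).toLeft.card + t.toLeft.card = s.toLeft.card := by
      rw [Finset.toLeft_sdiff]
      exact Finset.card_sdiff_add_card_eq_card (Finset.toLeft_subset_toLeft hts)
    have hr : (s \ t).toRight.card + t.toRight.card = s.toRight.card := by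
      rw [Finset.toRight_sdiff]
      exact Finset.card_sdiff_add_card_eq_card (Finset.toRight_subset_toRight hts)
    rcases (s \ t).toRight.eq_empty_or_nonempty with h | h
    · rw [h, Finset.card_empty, zero_add] at hr
      rw [← hr]
      omega
    · have := ih (s \ t) (Finset.sdiff_ssubset hts ⟨_, hkt⟩) (hs.sdiff hrel hts) h
      rw [← hr, mul_add]
      omega

/-! ### Polarization and restriction to lines -/

open Polynomial in
/-- Polarization of a relation between values of polynomials at the values of all linear forms. -/
theorem sum_coeff_mul_prod_eq_zero {F V Γ : Type*} [Field F] [AddCommGroup V] [Module F V]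
    (vec : Γ → V) (s : Finset Γ) (n : ℕ) (h : Γ → F[X]) (hdeg : ∀ γ, (h γ).natDegree ≤ n)
    (hsum : ∀ l : Module.Dual F V, ∑ γ ∈ s, (h γ).eval (l (vec γ)) = 0)
    (l : Fin n → Module.Dual F V) :
    ∑ γ ∈ s, (n.factorial : F) * (h γ).coeff n * ∏ i, l i (vec γ) = 0 := by
  induction n generalizing h with
  | zero =>
    rw [← hsum 0]
    refine Finset.sum_congr rfl fun γ _ => ?_
    rw [eq_C_of_natDegree_le_zero (hdeg γ)]
    simp
  | succ n ih =>
    -- Differencing in the direction `l 0` lowers the degree by one and multiplies the top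
    -- coefficient by `(n + 1) * l 0 (vec γ)`; iterating produces the factorial.
    have hcoeff : ∀ γ r, (taylor r (h γ) - h γ).coeff n = (n + 1) * (h γ).coeff (n + 1) * r := by
      intro γ r
      rw [coeff_sub, taylor_coeff, eval_eq_sum_range' (n := 2)]
      · simp [Finset.sum_range_succ, hasseDeriv_coeff, add_comm 1 n]
      · refine lt_of_le_of_lt (natDegree_hasseDeriv_le _ _) ?_
        have := hdeg γ
        omega
    have key := ih (fun γ => taylor (l 0 (vec γ)) (h γ) - h γ) (fun γ => by
      rw [natDegree_le_iff_coeff_eq_zero]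
      intro N hN
      rw [coeff_sub]
      rcases Nat.lt_or_ge (n + 1) N with h1 | h1
      · rw [coeff_eq_zero_of_natDegree_lt, coeff_eq_zero_of_natDegree_lt, sub_zero]
        · exact (hdeg γ).trans_lt h1
        · rw [natDegree_taylor]
          exact (hdeg γ).trans_lt h1
      · obtain rfl : N = n + 1 := by omega
        rw [taylor_coeff, eval_eq_sum_range' (n := 1)]
        · simp [hasseDeriv_coeff]
        · refine lt_of_le_of_lt (natDegree_hasseDeriv_le _ _) ?_
          have := hdeg γ
          omega) (fun m => by
        have h1 := hsum (m + l 0)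
        have h2 := hsum m
        simp only [eval_sub, taylor_eval, Finset.sum_sub_distrib]
        simp only [LinearMap.add_apply] at h1
        rw [h1, h2, sub_zero]) (fun i => l i.succ)
    rw [← key]
    refine Finset.sum_congr rfl fun γ _ => ?_
    rw [hcoeff, Fin.prod_univ_succ, Nat.factorial_succ]
    push_cast
    ring

section Restriction

variable {F V U ι : Type*} [Field F] [AddCommGroup V] [Module F V] [AddCommGroup U] [Module F U]
  [Fintype ι]

open Polynomial in
/-- Applied to a linear form, a polynomial map restricts to a polynomial on each line through the
origin, whose top coefficient is the top homogeneous part. -/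
theorem exists_polynomial_eval_smul (b : Module.Basis ι F V) (a : (ι →₀ ℕ) →₀ U)
    (φ : Module.Dual F U) (u : V) :
    ∃ h : F[X], h.natDegree ≤ polyDegree a ∧ (∀ t, h.eval t = φ (polyEval b a (t • u))) ∧
      h.coeff (polyDegree a) =
        ∑ m ∈ a.support with ∑ i, m i = polyDegree a, φ (a m) * ∏ i, b.repr u i ^ m i := by
  refine ⟨∑ m ∈ a.support, C (φ (a m) * ∏ i, b.repr u i ^ m i) * X ^ (∑ i, m i), ?_, ?_, ?_⟩
  · refine natDegree_sum_le_of_forall_le _ _ fun m hm => ?_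
    exact (natDegree_C_mul_X_pow_le _ _).trans
      (Finset.le_sup (f := fun m : ι →₀ ℕ => ∑ i, m i) hm)
  · intro t
    rw [polyEval, Finsupp.sum, map_sum, eval_finsetSum]
    refine Finset.sum_congr rfl fun m _ => ?_
    simp only [eval_mul, eval_C, eval_pow, eval_X, map_smul, Finsupp.smul_apply, smul_eq_mul,
      mul_pow, Finset.prod_mul_distrib, Finset.prod_pow_eq_pow_sum]
    ring
  · rw [finsetSum_coeff, Finset.sum_filter]
    refine Finset.sum_congr rfl fun m _ => ?_
    rw [coeff_C_mul, coeff_X_pow]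
    simp [eq_comm]

/-- A canonical polynomial map of degree `d ≥ 1` has, on some line through the origin, and after
applying some linear form, a restriction of degree exactly `d`. -/
theorem exists_polynomial_coeff_ne_zero [Fintype F] (b : Module.Basis ι F V) (a : (ι →₀ ℕ) →₀ U)
    (ha : IsCanonical F a) (hd : 1 ≤ polyDegree a) :
    ∃ (φ : Module.Dual F U) (u : V) (h : Polynomial F), h.natDegree ≤ polyDegree a ∧
      (∀ t, h.eval t = φ (polyEval b a (t • u))) ∧ h.coeff (polyDegree a) ≠ 0 := by
  classical
  obtain ⟨m₀, hm₀, hdeg⟩ : ∃ m ∈ a.support, polyDegree a = ∑ i, m i :=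
    Finset.exists_mem_eq_sup _ (by
      rw [Finset.nonempty_iff_ne_empty]
      intro h
      simp [polyDegree, h] at hd) _
  obtain ⟨φ, hφ⟩ := Module.Projective.exists_dual_ne_zero F (Finsupp.mem_support_iff.1 hm₀)
  set p : MvPolynomial ι F := ∑ m ∈ a.support with ∑ i, m i = polyDegree a,
    MvPolynomial.monomial m (φ (a m)) with hp
  have hcoeff : p.coeff m₀ = φ (a m₀) := by
    rw [hp, MvPolynomial.coeff_sum]
    simp only [MvPolynomial.coeff_monomial]
    rw [Finset.sum_ite_eq' , if_pos (Finset.mem_filter.2 ⟨hm₀, hdeg.symm⟩)]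
  obtain ⟨x, hx⟩ : ∃ x : ι → F, MvPolynomial.eval x p ≠ 0 := by
    by_contra! hall
    have : p = 0 := by
      -- Canonical form matters here: with all exponents below `|F|`, a polynomial vanishing at
      -- every point is zero.
      refine MvPolynomial.eq_zero_of_eval_zero_at_prod_finset p (fun _ => Finset.univ)
        (fun i => ?_) fun x _ => hall x
      rw [Finset.card_univ]
      refine lt_of_le_of_lt (b := Fintype.card F - 1) ?_ (Nat.sub_lt Fintype.card_pos one_pos)
      rw [MvPolynomial.degreeOf_le_iff]
      intro m hm
      obtain ⟨m', hm', h⟩ := Finset.mem_biUnion.1 (MvPolynomial.support_sum hm)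
      obtain rfl := Finset.mem_singleton.1 (MvPolynomial.support_monomial_subset h)
      exact ha _ (Finset.mem_filter.1 hm').1 i
    rw [this, MvPolynomial.coeff_zero] at hcoeff
    exact hφ hcoeff.symm
  obtain ⟨h, h1, h2, h3⟩ := exists_polynomial_eval_smul b a φ (b.equivFun.symm x)
  refine ⟨φ, _, h, h1, h2, ?_⟩
  rw [h3]
  convert hx using 1
  rw [hp, map_sum]
  refine Finset.sum_congr rfl fun m _ => ?_
  rw [MvPolynomial.eval_monomial, Finsupp.prod_fintype _ _ (by simp)]
  congr 2 with i
  rw [← b.equivFun_apply, LinearEquiv.apply_symm_apply]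

end Restriction

/-! ### The lower bound on the number of workers -/

namespace LinearScheme

/-- A valid scheme in which every worker that uses an input also uses a key has at least
`K (d - 1) + 2` workers. -/
theorem IsValid.le_card {F V U ι W : Type*} [Field F] [Fintype F] [AddCommGroup V] [Module F V]
    [AddCommGroup U] [Module F U] [Fintype ι] [Fintype W] {K T : ℕ} (hK : 1 ≤ K)
    {S : LinearScheme F K T W} {b : Module.Basis ι F V} {a : (ι →₀ ℕ) →₀ U}
    (ha : IsCanonical F a) (hd : 1 ≤ polyDegree a) (hchar : polyDegree a < ringChar F)
    (hS : S.IsValid (polyEval b a))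
    (hkey : ∀ w, (∀ t, S.keyCoeff w t = 0) → ∀ k, S.inputCoeff w k = 0) :
    K * (polyDegree a - 1) + 2 ≤ Fintype.card W := by
  classical
  obtain ⟨φ, u, h, hdeg, heval, hne⟩ := exists_polynomial_coeff_ne_zero b a ha hd
  generalize polyDegree a = d at *
  obtain ⟨n, rfl⟩ : ∃ n, d = n + 1 := ⟨d - 1, by omega⟩
  have hfac : ((n + 1).factorial : F) ≠ 0 := by
    have : Fact (ringChar F).Prime := ⟨CharP.char_is_prime F _⟩
    rw [Ne, ringChar.spec, (Fact.out : (ringChar F).Prime).dvd_factorial]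
    omega
  let v : W → Fin K ⊕ Fin T → F := fun w => Sum.elim (S.inputCoeff w) (S.keyCoeff w)
  let e : Fin K → Fin K ⊕ Fin T → F := fun k => Pi.single (.inl k) 1
  let c : W ⊕ Fin K → F := Sum.elim S.decCoeff fun _ => -1
  have hrel : IsPowerRelation (n + 1) (Sum.elim v e) c Finset.univ := by
    intro l
    have key := sum_coeff_mul_prod_eq_zero (Sum.elim v e) Finset.univ (n + 1)
      (fun γ => Polynomial.C (c γ) * h)
      (fun γ => (Polynomial.natDegree_C_mul_le _ _).trans hdeg) (fun m => by
        have hm : ∀ y : Fin K ⊕ Fin T → F, m y = ∑ j, y j * m (Pi.single j 1) := by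
          intro y
          conv_lhs => rw [pi_eq_sum_univ' y, map_sum]
          simp only [map_smul, smul_eq_mul]
        -- A linear form `m` on the coefficient space amounts to a choice of multiples of `u` for
        -- all inputs and keys; worker `w` then stores `m (v w) • u`.
        have h1 := congrArg φ (hS (fun k => m (Pi.single (.inl k) 1) • u)
          fun t => m (Pi.single (.inr t) 1) • u)
        simp only [decode, map_sum, map_smul, ← heval] at h1
        simp only [Fintype.sum_sum_type, Polynomial.eval_mul, Polynomial.eval_C, Sum.elim_inl,
          Sum.elim_inr, c, neg_one_mul, Finset.sum_neg_distrib, e]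
        rw [add_neg_eq_zero, ← h1]
        refine Finset.sum_congr rfl fun w _ => ?_
        rw [heval, smul_eq_mul, encode, hm, Fintype.sum_sum_type]
        simp only [v, Sum.elim_inl, Sum.elim_inr, add_smul, Finset.sum_smul, smul_smul]) l
    have h2 : ((n + 1).factorial : F) * h.coeff (n + 1) *
        ∑ γ, c γ * ∏ i, l i (Sum.elim v e γ) = 0 := by
      rw [← key, Finset.mul_sum]
      refine Finset.sum_congr rfl fun γ _ => ?_
      rw [Polynomial.coeff_C_mul]
      ring
    exact (mul_eq_zero.1 h2).resolve_left (mul_ne_zero hfac hne)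
  -- Workers without keys are zero vectors and drop out of the relation, because the degree `n + 1`
  -- is positive.
  let W' := {w : W // ∃ t, S.keyCoeff w t ≠ 0}
  have hrel' : IsPowerRelation (n + 1) (Sum.elim (fun w : W' => v w) e)
      (Sum.elim (fun w : W' => S.decCoeff w) fun _ => -1) Finset.univ := by
    intro l
    refine Eq.trans ?_ (hrel l)
    rw [Fintype.sum_sum_type, Fintype.sum_sum_type]
    congr 1
    refine Fintype.sum_of_injective (Subtype.val : W' → W) Subtype.val_injective _ _ ?_ ?_
    · intro w hw
      have hw' : ∀ t, S.keyCoeff w t = 0 := by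
        by_contra! hcon
        exact hw ⟨⟨w, hcon⟩, rfl⟩
      have : v w = 0 := by
        ext (k | t)
        · exact hkey w hw' k
        · exact hw' t
      simp [this]
    · intro w
      rfl
  have hli : LinearIndependent F e := by
    have h := (Pi.basisFun F (Fin K ⊕ Fin T)).linearIndependent.comp _
      (Sum.inl_injective (α := Fin K) (β := Fin T))
    convert h using 1
    ext k j
    simp [e]
  have hbound := IsPowerRelation.le_card_toLeft hli (fun w hw => by
    obtain ⟨t, ht⟩ := w.2
    have : Submodule.span F (Set.range e) ≤ LinearMap.ker (LinearMap.proj (.inr t) :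
        (Fin K ⊕ Fin T → F) →ₗ[F] F) := by
      rw [Submodule.span_le]
      rintro _ ⟨k, rfl⟩
      simp [e]
    exact ht (this hw)) (by simp) _ hrel' ⟨⟨0, hK⟩, by simp⟩
  have hr : (Finset.univ : Finset (W' ⊕ Fin K)).toRight = Finset.univ := by ext; simp
  have hl : (Finset.univ : Finset (W' ⊕ Fin K)).toLeft = Finset.univ := by ext; simp
  rw [hr, hl, Finset.card_univ, Finset.card_univ, Fintype.card_fin] at hbound
  have := Fintype.card_subtype_le fun w => ∃ t, S.keyCoeff w t ≠ 0
  rw [Nat.add_sub_cancel, mul_comm]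
  exact hbound.trans this

end LinearScheme

/-! ### Mutual information and data privacy -/

noncomputable section

/-- Independent variables have mutual information zero. -/
theorem mutualInfo_eq_zero_of_mul {A B : Type*} [Fintype A] [Fintype B] (p : PMF (A × B))
    (q : PMF A) (r : PMF B) (h : ∀ x y, p (x, y) = q x * r y) : mutualInfo p = 0 := by
  classical
  have h1 : ∀ x, (p.map Prod.fst) x = q x := by
    intro x
    rw [PMF.map_apply, tsum_fintype, Fintype.sum_prod_type, Finset.sum_eq_single x]
    · simp only [if_true, h]
      rw [← Finset.mul_sum, ← tsum_fintype (L := .unconditional B), r.tsum_coe, mul_one]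
    · intro y _ hy
      simp [hy.symm]
    · simp
  have h2 : ∀ y, (p.map Prod.snd) y = r y := by
    intro y
    rw [PMF.map_apply, tsum_fintype, Fintype.sum_prod_type_right, Finset.sum_eq_single y]
    · simp only [if_true, h]
      rw [← Finset.sum_mul, ← tsum_fintype (L := .unconditional A), q.tsum_coe, one_mul]
    · intro x _ hx
      simp [hx.symm]
    · simp
  refine Finset.sum_eq_zero fun x _ => Finset.sum_eq_zero fun y _ => ?_
  rw [h1, h2, h, ENNReal.toReal_mul]
  rcases eq_or_ne ((q x).toReal * (r y).toReal) 0 with h0 | h0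
  · rw [h0, zero_mul]
  · rw [div_self h0, Real.log_one, mul_zero]

/-- If the second variable is a function of the first one and their mutual information is zero,
then this function is constant on the support of the law. -/
theorem eq_of_mutualInfo_map_eq_zero {A B : Type*} [Fintype A] [Fintype B] (μ : PMF A) (f : A → B)
    (h : mutualInfo (μ.map fun x => (x, f x)) = 0) {x y : A} (hx : μ x ≠ 0) (hy : μ y ≠ 0) :
    f x = f y := by
  classical
  set p := μ.map fun x => (x, f x) with hp
  have h1 : p.map Prod.fst = μ := by
    rw [hp, PMF.map_comp]
    exact PMF.map_id μ
  have h2 : p.map Prod.snd = μ.map f := by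
    rw [hp, PMF.map_comp]
    rfl
  have h3 : ∀ x y, p (x, y) = if y = f x then μ x else 0 := by
    intro x y
    rw [hp, PMF.map_apply, tsum_fintype, Finset.sum_eq_single x]
    · simp
    · intro x' _ hx'
      simp [hx'.symm]
    · simp
  have hle : ∀ y, ((μ.map f) y).toReal ≤ 1 := fun y =>
    ENNReal.toReal_le_of_le_ofReal zero_le_one (by
      rw [ENNReal.ofReal_one]
      exact PMF.coe_le_one _ y)
  -- The mutual information is here the entropy of `f`, a sum of nonnegative terms; so each value
  -- attained with positive probability has probability `1`.
  have h4 : ∑ x, (μ x).toReal * -Real.log ((μ.map f) (f x)).toReal = 0 := by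
    rw [← h, mutualInfo]
    refine Finset.sum_congr rfl fun x _ => ?_
    rw [Finset.sum_eq_single (f x)]
    · rw [h1, h2, h3, if_pos rfl]
      rcases eq_or_ne (μ x).toReal 0 with h0 | h0
      · rw [h0, zero_mul, zero_mul]
      · rw [div_mul_cancel_left₀ h0, Real.log_inv]
    · intro y _ hy
      rw [h3, if_neg hy]
      simp
    · simp
  rw [Finset.sum_eq_zero_iff_of_nonneg fun x _ => mul_nonneg ENNReal.toReal_nonneg
    (neg_nonneg.2 (Real.log_nonpos ENNReal.toReal_nonneg (hle _)))] at h4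
  have h5 := h4 x (Finset.mem_univ x)
  have hpos : (μ x).toReal ≠ 0 := ENNReal.toReal_ne_zero.2 ⟨hx, μ.apply_ne_top x⟩
  have hmem : ∀ x, μ x ≠ 0 → f x ∈ (μ.map f).support := fun x hx =>
    (PMF.mem_support_map_iff _ _ _).2 ⟨x, (PMF.mem_support_iff _ _).2 hx, rfl⟩
  have hpos' : 0 < ((μ.map f) (f x)).toReal :=
    ENNReal.toReal_pos ((PMF.mem_support_iff _ _).1 (hmem x hx)) (PMF.apply_ne_top _ _)
  have h6 : ((μ.map f) (f x)).toReal = 1 := by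
    refine Real.eq_one_of_pos_of_log_eq_zero hpos' ?_
    simpa [hpos] using h5
  have h7 : (μ.map f) (f x) = 1 := (ENNReal.toReal_eq_one_iff _).1 h6
  have h8 := hmem y hy
  rw [(PMF.apply_eq_one_iff _ _).1 h7] at h8
  exact h8.symm

/-- A bijection transports the uniform law to the uniform law. -/
theorem map_uniformOfFintype_apply {A B : Type*} [Fintype A] [Nonempty A] [Fintype B] [Nonempty B]
    (e : A ≃ B) (y : B) :
    ((PMF.uniformOfFintype A).map e) y = PMF.uniformOfFintype B y := by
  classical
  rw [PMF.map_apply, tsum_fintype, Finset.sum_eq_single (e.symm y)]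
  · simp [Fintype.card_congr e]
  · intro x _ hx
    rw [if_neg]
    rintro rfl
    simp at hx
  · simp

namespace LinearScheme

variable {F V W : Type*} {K T : ℕ} [Field F] [AddCommGroup V] [Module F V] [Fintype V]

/-- A scheme with one key, which every worker uses, is private. -/
theorem isPrivate_of_keyCoeff_ne_zero (S : LinearScheme F K 1 W)
    (h : ∀ w, S.keyCoeff w 0 ≠ 0) : S.IsPrivate V := by
  classical
  intro w μ
  refine mutualInfo_eq_zero_of_mul _ μ (PMF.uniformOfFintype V) fun x y => ?_
  -- One-time pad: for fixed inputs the code is a bijective function of the key, hence uniform.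
  let e : (Fin K → V) → (Fin 1 → V) ≃ V := fun x =>
    ((Equiv.funUnique (Fin 1) V).trans
      (LinearEquiv.smulOfNeZero F V (S.keyCoeff w 0) (h w)).toEquiv).trans
      (Equiv.addLeft (∑ k, S.inputCoeff w k • x k))
  have he : ∀ x z, S.encode w x z = e x z := by
    intro x z
    simp [encode, e]
  rw [jointLaw, PMF.bind_apply, tsum_fintype, Finset.sum_eq_single x]
  · congr 1
    rw [← map_uniformOfFintype_apply (e x) y, PMF.map_apply, PMF.map_apply]
    refine tsum_congr fun z => ?_
    simp [he]
  · intro x' _ hx'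
    rw [PMF.map_apply, ENNReal.tsum_eq_zero.2, mul_zero]
    intro z
    simp [hx'.symm]
  · simp

/-- In a private scheme, a worker that uses no key uses no input. -/
theorem IsPrivate.inputCoeff_eq_zero [Nontrivial V] {S : LinearScheme F K T W}
    (hS : S.IsPrivate V) {w : W} (hw : ∀ t, S.keyCoeff w t = 0) (k : Fin K) :
    S.inputCoeff w k = 0 := by
  classical
  have h := hS w (PMF.uniformOfFintype (Fin K → V))
  have henc : ∀ (x : Fin K → V) z, S.encode w x z = ∑ k, S.inputCoeff w k • x k := by
    intro x z
    simp [encode, hw]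
  have hlaw : S.jointLaw w (PMF.uniformOfFintype (Fin K → V)) =
      (PMF.uniformOfFintype (Fin K → V)).map fun x => (x, ∑ k, S.inputCoeff w k • x k) := by
    simp only [jointLaw, henc]
    exact congrArg _ (funext fun x => PMF.map_const _ _)
  rw [hlaw] at h
  obtain ⟨v, hv⟩ := exists_ne (0 : V)
  have h0 := eq_of_mutualInfo_map_eq_zero _ _ h (x := Pi.single k v) (y := 0) (by simp) (by simp)
  simp only [Pi.zero_apply, smul_zero, Finset.sum_const_zero] at h0
  rw [Finset.sum_eq_single k (by
    intro j _ hj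
    simp [hj]) (by simp), Pi.single_eq_same] at h0
  exact (smul_eq_zero.1 h0).resolve_right hv

end LinearScheme

end

/-! ### Interpolation on a line -/

noncomputable section

open Polynomial in
/-- Applied to a linear form, a polynomial map restricts to a polynomial on each line. -/
theorem exists_polynomial_eval_line {F V U ι : Type*} [Field F] [AddCommGroup V] [Module F V]
    [AddCommGroup U] [Module F U] [Fintype ι] (b : Module.Basis ι F V) (a : (ι →₀ ℕ) →₀ U)
    (φ : Module.Dual F U) (x y : V) :
    ∃ h : F[X], h.natDegree ≤ polyDegree a ∧ ∀ t, h.eval t = φ (polyEval b a (x + t • y)) := by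
  refine ⟨∑ m ∈ a.support, C (φ (a m)) * ∏ i, (C (b.repr y i) * X + C (b.repr x i)) ^ m i,
    ?_, ?_⟩
  · refine natDegree_sum_le_of_forall_le _ _ fun m hm => ?_
    refine (natDegree_C_mul_le _ _).trans (le_trans ?_
      (Finset.le_sup (f := fun m : ι →₀ ℕ => ∑ i, m i) hm))
    refine (natDegree_prod_le _ _).trans (Finset.sum_le_sum fun i _ => ?_)
    refine (natDegree_pow_le_of_le _ natDegree_linear_le).trans (by rw [mul_one])
  · intro t
    rw [polyEval, Finsupp.sum, map_sum, eval_finsetSum]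
    refine Finset.sum_congr rfl fun m _ => ?_
    simp only [eval_mul, eval_C, eval_prod, eval_pow, eval_add, eval_X, map_add, map_smul,
      Finsupp.add_apply, Finsupp.smul_apply, smul_eq_mul]
    rw [mul_comm]
    congr 1
    refine Finset.prod_congr rfl fun i _ => ?_
    ring

/-- The divided difference of a polynomial of degree at most `n + 1` at `n + 3` points, three of
which are singled out, vanishes. -/
theorem divided_difference_eq_zero {F : Type*} [Field F] [DecidableEq F] {n : ℕ}
    {β : Fin n → F} {o a b : F} (hβ : Function.Injective β) (hoβ : ∀ i, β i ≠ o)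
    (haβ : ∀ i, β i ≠ a) (hbβ : ∀ i, β i ≠ b) (hoa : o ≠ a) (hob : o ≠ b) (hab : a ≠ b)
    (h : Polynomial F) (hdeg : h.natDegree ≤ n + 1) :
    h.eval o / ((o - a) * ((o - b) * ∏ i, (o - β i)))
      + (h.eval a / ((a - o) * ((a - b) * ∏ i, (a - β i)))
      + (h.eval b / ((b - o) * ((b - a) * ∏ i, (b - β i)))
      + ∑ i, h.eval (β i) / ((β i - o) * ((β i - a) * ((β i - b) *
          ∏ j ∈ Finset.univ.erase i, (β i - β j)))))) = 0 := by
  set B : Finset F := Finset.univ.image β with hB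
  have hbB : b ∉ B := by simp [hB, hbβ]
  have haB : a ∉ B := by simp [hB, haβ]
  have hoB : o ∉ B := by simp [hB, hoβ]
  have haB' : a ∉ insert b B := by simp [hab, haB]
  have hoB' : o ∉ insert a (insert b B) := by simp [hoa, hob, hoB]
  have hcard : B.card = n := by rw [hB, Finset.card_image_of_injective _ hβ]; simp
  set s := insert o (insert a (insert b B)) with hs
  have hscard : s.card = n + 3 := by
    rw [hs, Finset.card_insert_of_notMem hoB', Finset.card_insert_of_notMem haB',
      Finset.card_insert_of_notMem hbB, hcard]
  -- Over `n + 3` nodes the Lagrange sum is the coefficient of degree `n + 2`, which is zero.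
  have key := Lagrange.coeff_eq_sum (s := s) (v := id) Function.injective_id.injOn (P := h) (by
    refine lt_of_le_of_lt Polynomial.degree_le_natDegree ?_
    rw [hscard]
    exact_mod_cast (by omega : h.natDegree < n + 3))
  rw [hscard, Polynomial.coeff_eq_zero_of_natDegree_lt (by omega)] at key
  have eo : s.erase o = insert a (insert b B) := Finset.erase_insert hoB'
  have ea : s.erase a = insert o (insert b B) := by
    rw [hs, Finset.insert_comm, Finset.erase_insert]
    simp [hoa.symm, haB']
  have eb : s.erase b = insert o (insert a B) := by
    rw [hs, Finset.insert_comm a b, Finset.insert_comm o b, Finset.erase_insert]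
    simp [hob.symm, hab.symm, hbB]
  have eβ : ∀ i, s.erase (β i) =
      insert o (insert a (insert b ((Finset.univ.erase i).image β))) := by
    intro i
    have : (Finset.univ.erase i).image β = B.erase (β i) := by
      rw [hB, Finset.image_erase hβ]
    rw [this, hs, Finset.erase_insert_of_ne (hoβ i).symm, Finset.erase_insert_of_ne (haβ i).symm,
      Finset.erase_insert_of_ne (hbβ i).symm]
  rw [hs, Finset.sum_insert hoB', Finset.sum_insert haB', Finset.sum_insert hbB, ← hs, eo, ea, eb,
    hB, Finset.sum_image hβ.injOn] at key
  simp only [id] at key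
  rw [← hB, Finset.prod_insert haB', Finset.prod_insert hbB, Finset.prod_insert (by
    simp [hob, hoB]), Finset.prod_insert hbB, Finset.prod_insert (by simp [hoa, hoB]),
    Finset.prod_insert haB, hB, Finset.prod_image hβ.injOn, Finset.prod_image hβ.injOn,
    Finset.prod_image hβ.injOn] at key
  rw [key]
  congr 3
  refine Finset.sum_congr rfl fun i _ => ?_
  have hsub : ∀ x ∉ B, x ∉ (Finset.univ.erase i).image β := fun x hx hx' =>
    hx (Finset.image_subset_image (Finset.erase_subset _ _) hx')
  rw [eβ, Finset.prod_insert (by simp only [Finset.mem_insert, not_or]; exact ⟨hoa, hob, hsub o hoB⟩),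
    Finset.prod_insert (by simp only [Finset.mem_insert, not_or]; exact ⟨hab, hsub a haB⟩),
    Finset.prod_insert (hsub b hbB), Finset.prod_image hβ.injOn]

/-- Interpolation at `0` of a polynomial on a line, with the weights of Harmonic Coding. -/
theorem eval_zero_eq_harmonic {F : Type*} [Field F] {n : ℕ} {β : Fin n → F} {c e e' : F}
    (hc : c ≠ 0) (he : e ≠ 0) (he' : e' ≠ 0) (hee : e' = e - 1) (hβ : Function.Injective β)
    (h0 : ∀ i, β i ≠ 0) (h1 : ∀ i, β i ≠ c / e) (h2 : ∀ i, β i ≠ c / e')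
    (h : Polynomial F) (hdeg : h.natDegree ≤ n + 1) :
    h.eval 0 = (e * ∏ i, (β i * e / (β i * e - c))) * h.eval (c / e)
      - (e' * ∏ i, (β i * e' / (β i * e' - c))) * h.eval (c / e')
      + ∑ i, ((e / e') / ((1 - β i * (e / c)) * (e / e' - β i * (e / c)))
          * ∏ i' ∈ Finset.univ.erase i, (β i' / (β i' - β i))) * h.eval (β i) := by
  classical
  have key := divided_difference_eq_zero (o := 0) (a := c / e) (b := c / e') hβ h0 h1 h2
    (div_ne_zero hc he).symm (div_ne_zero hc he').symm (by
      rw [Ne, div_eq_div_iff he he', mul_right_inj' hc, hee]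
      simp) h hdeg
  have hprod0 : ∏ i, (0 - β i) ≠ 0 := Finset.prod_ne_zero_iff.2 fun i _ => by simpa using h0 i
  set D := (0 - c / e) * ((0 - c / e') * ∏ i, (0 - β i)) with hD
  have hD0 : D ≠ 0 := by
    simp only [hD, zero_sub] at hprod0 ⊢
    exact mul_ne_zero (neg_ne_zero.2 (div_ne_zero hc he))
      (mul_ne_zero (neg_ne_zero.2 (div_ne_zero hc he')) hprod0)
  have hprod : ∀ f : F, f ≠ 0 → (∀ i, β i ≠ c / f) →
      ∏ i, (0 - β i) = (∏ i, (β i * f / (β i * f - c))) * ∏ i, (c / f - β i) := by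
    intro f hf hβf
    rw [← Finset.prod_mul_distrib]
    refine Finset.prod_congr rfl fun i _ => ?_
    have : β i * f - c ≠ 0 := by
      rw [sub_ne_zero, Ne, ← eq_div_iff hf]
      exact hβf i
    field_simp
    ring
  have hne : ∀ f : F, (∀ i, β i ≠ c / f) → ∏ i, (c / f - β i) ≠ 0 := fun f hβf =>
    Finset.prod_ne_zero_iff.2 fun i _ => sub_ne_zero.2 (hβf i).symm
  have hdiff : c / e - c / e' ≠ 0 := by
    rw [sub_ne_zero, Ne, div_eq_div_iff he he', mul_right_inj' hc, hee]
    simp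
  -- Here `e' = e - 1` turns the factor `e / (e' - e)` into `-e`, so that the weight no longer
  -- involves `e'`.
  have hA : D / ((c / e - 0) * ((c / e - c / e') * ∏ i, (c / e - β i)))
      = -(e * ∏ i, (β i * e / (β i * e - c))) := by
    have := hne e h1
    rw [hD, hprod e he h1, div_eq_iff (by
      rw [sub_zero]
      exact mul_ne_zero (div_ne_zero hc he) (mul_ne_zero hdiff this))]
    generalize (∏ i, (β i * e / (β i * e - c))) = p
    field_simp
    rw [hee]
    ring
  have hB : D / ((c / e' - 0) * ((c / e' - c / e) * ∏ i, (c / e' - β i)))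
      = e' * ∏ i, (β i * e' / (β i * e' - c)) := by
    have := hne e' h2
    rw [hD, hprod e' he' h2, div_eq_iff (by
      rw [sub_zero]
      exact mul_ne_zero (div_ne_zero hc he') (mul_ne_zero (by
        rw [← neg_sub]
        exact neg_ne_zero.2 hdiff) this))]
    generalize (∏ i, (β i * e' / (β i * e' - c))) = p
    field_simp
    rw [hee]
    ring
  have hW : ∀ i, D / ((β i - 0) * ((β i - c / e) * ((β i - c / e') *
      ∏ j ∈ Finset.univ.erase i, (β i - β j)))) =
      -((e / e') / ((1 - β i * (e / c)) * (e / e' - β i * (e / c)))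
          * ∏ i' ∈ Finset.univ.erase i, (β i' / (β i' - β i))) := by
    intro i
    have hne' : ∏ j ∈ Finset.univ.erase i, (β i - β j) ≠ 0 :=
      Finset.prod_ne_zero_iff.2 fun j hj => sub_ne_zero.2 fun hij =>
        Finset.ne_of_mem_erase hj (hβ hij.symm)
    have hp : ∏ i, (0 - β i) = (0 - β i) * ((∏ i' ∈ Finset.univ.erase i, (β i' / (β i' - β i))) *
        ∏ j ∈ Finset.univ.erase i, (β i - β j)) := by
      rw [← Finset.mul_prod_erase _ _ (Finset.mem_univ i), ← Finset.prod_mul_distrib]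
      congr 1
      refine Finset.prod_congr rfl fun j hj => ?_
      have : β j - β i ≠ 0 := sub_ne_zero.2 fun hij => Finset.ne_of_mem_erase hj (hβ hij)
      field_simp
      ring
    have hi1 : β i - c / e ≠ 0 := sub_ne_zero.2 (h1 i)
    have hi2 : β i - c / e' ≠ 0 := sub_ne_zero.2 (h2 i)
    have hf1 : 1 - β i * (e / c) = -(e / c) * (β i - c / e) := by
      field_simp
      ring
    have hf2 : e / e' - β i * (e / c) = -(e / c) * (β i - c / e') := by
      field_simp
      ring
    have := h0 i
    rw [hD, hp, hf1, hf2, sub_zero]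
    generalize (∏ i' ∈ Finset.univ.erase i, (β i' / (β i' - β i))) = p
    generalize (∏ j ∈ Finset.univ.erase i, (β i - β j)) = q at *
    generalize β i - c / e = r at *
    generalize β i - c / e' = r' at *
    field_simp
    ring
  have key2 := congrArg (D * ·) key
  simp only [mul_zero, mul_add, Finset.mul_sum, mul_div_left_comm D] at key2
  rw [div_self hD0, hA, hB] at key2
  simp only [hW] at key2
  simp only [mul_comm (Polynomial.eval _ h), neg_mul, Finset.sum_neg_distrib] at key2
  linear_combination key2

/-! ### Parameters and validity of Harmonic Coding -/

section HarmonicCoding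

variable {F : Type*} [Field F] {K d : ℕ} {c : F} {β : Fin (d - 1) → F}

theorem IsHarmonicParam.sub_ne_zero (h : IsHarmonicParam K d c β) {j : ℕ} (hj : j ≤ K) :
    c - (j : F) ≠ 0 :=
  _root_.sub_ne_zero.2 (h.c_ne j hj)

theorem IsHarmonicParam.ne (h : IsHarmonicParam K d c β) : c ≠ 0 := by
  simpa using h.c_ne 0 (Nat.zero_le _)

/-- Admissible parameters of Harmonic Coding exist over every field with at least `K + d + 1`
elements. -/
theorem exists_isHarmonicParam [Fintype F] (hd : 1 ≤ d) (hF : K + d + 1 ≤ Fintype.card F) :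
    ∃ (c : F) (β : Fin (d - 1) → F), IsHarmonicParam K d c β := by
  classical
  obtain ⟨c, -, hc⟩ : ∃ c ∈ (Finset.univ : Finset F),
      c ∉ (Finset.range (K + 1)).image (Nat.cast : ℕ → F) := by
    refine Finset.exists_mem_notMem_of_card_lt_card (Finset.card_image_le.trans_lt ?_)
    rw [Finset.card_range, Finset.card_univ]
    omega
  set s : Finset F := insert 0 ((Finset.range (K + 1)).image fun j : ℕ => c / (c - (j : F)))
    with hs
  have hs1 : s.card ≤ K + 2 := by
    refine (Finset.card_insert_le _ _).trans ?_
    have := Finset.card_image_le (s := Finset.range (K + 1)) (f := fun j : ℕ => c / (c - (j : F)))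
    rw [Finset.card_range] at this
    omega
  -- At most `K + 2` values are forbidden, and `(K + 2) + (d - 1) = K + d + 1`.
  obtain ⟨β⟩ : Nonempty (Fin (d - 1) ↪ (sᶜ : Finset F)) := by
    rw [Function.Embedding.nonempty_iff_card_le, Fintype.card_fin, Fintype.card_coe,
      Finset.card_compl]
    omega
  have hβ : ∀ i, (β i : F) ∉ s := fun i => Finset.mem_compl.1 (β i).2
  simp only [hs, Finset.mem_insert, Finset.mem_image, Finset.mem_range, not_or, not_exists,
    not_and, Nat.lt_succ_iff] at hβ hc
  exact ⟨c, fun i => β i, fun j hj h => hc j hj h.symm, Subtype.val_injective.comp β.injective,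
    fun i => (hβ i).1, fun i j hj h => (hβ i).2 j hj h.symm⟩

theorem IsHarmonicParam.keyCoeff_ne_zero (h : IsHarmonicParam K d c β) (w : HarmonicWorker K d) :
    (harmonicScheme K d c β).keyCoeff w 0 ≠ 0 := by
  have hkey : ∀ j ≤ K, harmonicPKey c j ≠ 0 := fun j hj => div_ne_zero h.ne (h.sub_ne_zero hj)
  rcases w with _ | ⟨i, j⟩ | _
  · exact hkey 0 (Nat.zero_le _)
  · exact mul_ne_zero (mul_ne_zero (h.ne_zero i) (div_ne_zero (h.sub_ne_zero j.2.le) h.ne))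
      (hkey j j.2.le)
  · exact hkey K le_rfl

/-- Harmonic Coding computes the sum of the values of every polynomial map of degree `d`. -/
theorem IsHarmonicParam.isValid {V U ι : Type*} [AddCommGroup V] [Module F V] [AddCommGroup U]
    [Module F U] [Fintype ι] (h : IsHarmonicParam K d c β) (hd : 1 ≤ d) (b : Module.Basis ι F V)
    (a : (ι →₀ ℕ) →₀ U) (ha : polyDegree a = d) :
    (harmonicScheme K d c β).IsValid (polyEval b a) := by
  intro x z
  let P : ℕ → V := fun j => ∑ k, harmonicPInput c j k • x k + harmonicPKey c j • z 0
  let R : ℕ → V := fun j => c • z 0 - ∑ k : Fin K, if (k : ℕ) < j then x k else 0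
  have hPR : ∀ j ≤ K, P j = (1 / (c - (j : F))) • R j := by
    intro j hj
    simp only [P, R, harmonicPInput, harmonicPKey, smul_sub, Finset.smul_sum, smul_smul]
    rw [add_comm, sub_eq_add_neg _ (∑ k : Fin K, _), ← Finset.sum_neg_distrib]
    congr 1
    · congr 1
      ring
    · refine Finset.sum_congr rfl fun k _ => ?_
      split_ifs <;> simp
  have hR : ∀ j : Fin K, R (j + 1) = R j - x j := by
    intro j
    simp only [R, sub_sub]
    congr 1
    rw [← Finset.add_sum_erase _ _ (Finset.mem_univ j),
      ← Finset.add_sum_erase (a := j) _ (fun k : Fin K => if (k : ℕ) < j then x k else 0)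
        (Finset.mem_univ j)]
    simp only [lt_add_iff_pos_right, zero_lt_one, if_true, lt_irrefl, if_false, zero_add]
    rw [add_comm]
    congr 1
    refine Finset.sum_congr rfl fun k hk => ?_
    have : (k : ℕ) ≠ j := fun hkj => Finset.ne_of_mem_erase hk (Fin.ext hkj)
    congr 1
    apply propext
    omega
  let A : ℕ → F := fun j => (c - (j : F)) * ∏ i, (β i * (c - (j : F)) / (β i * (c - (j : F)) - c))
  have hstep : ∀ j : Fin K, polyEval b a (x j) = A j • polyEval b a (P j)
      - A (j + 1) • polyEval b a (P (j + 1))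
      + ∑ i, (harmonicScheme K d c β).decCoeff (.inr (.inl (i, j))) •
        polyEval b a ((harmonicScheme K d c β).encode (.inr (.inl (i, j))) x z) := by
    intro j
    have he := h.sub_ne_zero j.2.le
    have he' : c - (((j : ℕ) + 1 : ℕ) : F) ≠ 0 := h.sub_ne_zero j.2
    have hc := h.ne
    have hee : c - (((j : ℕ) + 1 : ℕ) : F) = c - ((j : ℕ) : F) - 1 := by
      push_cast
      ring
    -- The direction of the line through `x j` and `P j`, scaled so that the workers of the group
    -- sit at the parameters `β i`.
    set y : V := (1 / c) • (R j - (c - ((j : ℕ) : F)) • x j) with hy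
    have hP : P j = x j + (c / (c - ((j : ℕ) : F))) • y := by
      rw [hPR j j.2.le, hy]
      match_scalars <;> field_simp
      ring
    have hP' : P (j + 1) = x j + (c / (c - (((j : ℕ) + 1 : ℕ) : F))) • y := by
      rw [hPR (j + 1) j.2, hR, hy]
      generalize c - (((j : ℕ) + 1 : ℕ) : F) = e' at *
      generalize c - ((j : ℕ) : F) = e at *
      subst hee
      match_scalars <;> field_simp
      ring
    have henc : ∀ i, (harmonicScheme K d c β).encode (.inr (.inl (i, j))) x z = x j + β i • y := by
      intro i
      have : (harmonicScheme K d c β).encode (.inr (.inl (i, j))) x z =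
          (1 - β i * ((c - ((j : ℕ) : F)) / c)) • x j
            + (β i * ((c - ((j : ℕ) : F)) / c)) • P j := by
        simp only [LinearScheme.encode, harmonicScheme, P, add_smul, Finset.sum_add_distrib,
          smul_add, Finset.smul_sum, smul_smul, ite_smul, zero_smul, Finset.sum_ite_eq',
          Finset.mem_univ, if_true, Fin.isValue,
          Finset.univ_unique, Finset.sum_singleton, Fin.default_eq_zero, add_assoc]
      rw [this, hPR j j.2.le, hy]
      match_scalars <;> field_simp
      ring
    rw [← sub_eq_zero, ← Module.forall_dual_apply_eq_zero_iff F]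
    intro φ
    obtain ⟨p, hp1, hp2⟩ := exists_polynomial_eval_line b a φ (x j) y
    have key := eval_zero_eq_harmonic hc he he' hee h.injective h.ne_zero
      (fun i => h.ne_harmonic i j j.2.le) (fun i => h.ne_harmonic i (j + 1) j.2) p (by omega)
    simp only [hp2, zero_smul, add_zero, ← hP, ← hP', ← henc] at key
    rw [map_sub, key]
    simp only [map_sub, map_add, map_sum, map_smul, smul_eq_mul]
    exact sub_self _
  have htel : ∑ j : Fin K, (A j • polyEval b a (P j) - A (j + 1) • polyEval b a (P (j + 1)))
      = A 0 • polyEval b a (P 0) - A K • polyEval b a (P K) := by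
    rw [Fin.sum_univ_eq_sum_range
      (fun j => A j • polyEval b a (P j) - A (j + 1) • polyEval b a (P (j + 1))) K]
    exact Finset.sum_range_sub' (fun j => A j • polyEval b a (P j)) K
  rw [Finset.sum_congr rfl fun j _ => hstep j, Finset.sum_add_distrib, htel, LinearScheme.decode,
    Fintype.sum_sum_type, Fintype.sum_sum_type, Fintype.sum_prod_type, Finset.sum_comm]
  simp only [Finset.univ_unique, Finset.sum_singleton]
  have h0 : (harmonicScheme K d c β).encode (.inl default) x z = P 0 := by
    simp [LinearScheme.encode, harmonicScheme, P]
  have hK : (harmonicScheme K d c β).encode (.inr (.inr default)) x z = P K := by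
    simp [LinearScheme.encode, harmonicScheme, P]
  have h0' : (harmonicScheme K d c β).decCoeff (.inl default) = A 0 := by
    simp [harmonicScheme, A]
  have hK' : (harmonicScheme K d c β).decCoeff (.inr (.inr default)) = -A K := rfl
  rw [h0, hK, h0', hK', neg_smul]
  abel

end HarmonicCoding

end

theorem theorem1 {F V U ι : Type*} [Field F] [Fintype F]
    [AddCommGroup V] [Module F V] [Fintype V] [AddCommGroup U] [Module F U] [Fintype ι]
    (K d : ℕ) (hK : 1 ≤ K) (hd : 1 ≤ d)
    (b : Module.Basis ι F V) (a : (ι →₀ ℕ) →₀ U) (g : V → U)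
    (hg : ∀ v, g v = polyEval b a v) (ha : IsCanonical F a) (hdeg : polyDegree a = d) :
    -- Harmonic Coding has `K (d - 1) + 2` workers
    Fintype.card (HarmonicWorker K d) = K * (d - 1) + 2 ∧
    -- its parameters can be chosen when the field is sufficiently large
    (K + d + 1 ≤ Fintype.card F →
      ∃ (c : F) (β : Fin (d - 1) → F), IsHarmonicParam K d c β) ∧
    -- for all admissible parameters it is data-private and valid
    (∀ (c : F) (β : Fin (d - 1) → F), IsHarmonicParam K d c β →
      (harmonicScheme K d c β).IsPrivate V ∧ (harmonicScheme K d c β).IsValid g) ∧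
    -- no valid data-private linear scheme has fewer workers when the characteristic exceeds `d`
    (d < ringChar F →
      ∀ (T : ℕ) (W : Type) [Fintype W] (S : LinearScheme F K T W),
        S.IsPrivate V → S.IsValid g → K * (d - 1) + 2 ≤ Fintype.card W) := by
  obtain rfl : g = polyEval b a := funext hg
  refine ⟨?_, exists_isHarmonicParam hd, fun c β h =>
    ⟨LinearScheme.isPrivate_of_keyCoeff_ne_zero _ h.keyCoeff_ne_zero, h.isValid hd b a hdeg⟩, ?_⟩
  · simp only [HarmonicWorker, Fintype.card_sum, Fintype.card_prod, Fintype.card_fin,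
      Fintype.card_unit]
    ring
  · subst hdeg
    intro hchar T W _ S hpriv hval
    -- Positive degree requires a variable, so `V` is nontrivial; on the zero space privacy would
    -- say nothing about the coefficients.
    have : Nonempty ι := by
      by_contra hι
      rw [not_nonempty_iff] at hι
      simp [polyDegree] at hd
    have : Nontrivial V := b.repr.toEquiv.nontrivial
    exact hval.le_card hK ha hd hchar fun w hw k => hpriv.inputCoeff_eq_zero hw k
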